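/- All graphs are finite, simple and undirected. For a graph $G$ with complement $\overline{G}$, the central graph $C(G)$ is obtained from $G$ by subdividing each edge exactly once and then joining every pair of distinct vertices of $G$ that are not adjacent in $G$; thus $V(C(G)) = V(G)\cup\{w_e : e\in E(G)\}$ and $E(C(G)) = E(\overline{G})\cup\{\{u,w_e\} : e\in E(G),\ u\in e\}$. A proper total coloring of a graph $H$ is a map $f$ on $V(H)\cup E(H)$ that gives different colors to any two adjacent vertices, to any two distinct edges with a common end, and to any vertex and edge incident with each other. An automorphism $\phi$ of $H$ preserves $f$ if $f(\phi(x))=f(x)$ for all $x\in V(H)\cup E(H)$. The total chromatic number $\chi''(H)$ is the least $k$ such that $H$ has a proper total coloring with $k$ colors, and the total distinguishing chromatic number $\chi''_D(H)$ is the least $k$ such that $H$ has a proper total coloring with $k$ colors that is preserved only by the identity automorphism. $\Delta(H)$ denotes the maximum degree of $H$, and $H$ is of Type 1 if $\chi''(H)=\Delta(H)+1$. Theorem 4.5. Let $G$ be a connected regular graph of order $n\geq 5$. 1. If $n$ is odd, then $\chi''_D(C(G))=\Delta(C(G))+1$. 2. If $n$ is even, $G\not\cong K_n$, and $\Delta(G)\leq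 \frac{2n-29}{6}$, then $\chi''_D(C(G))=\Delta(C(G))+1$. Consequently, $C(G)$ is of Type 1 whenever $G$ satisfies the requirement of (1) or of (2). -/

import Mathlib

namespace SimpleGraph

/-- The central graph `C(G)`: its vertices are the vertices of `G` together with one subdividing
vertex for each edge of `G`. A subdividing vertex is adjacent exactly to the two ends of its edge,
and two vertices of `G` are adjacent in `C(G)` iff they are distinct and not adjacent in `G`. -/
def centralGraph {V : Type*} (G : SimpleGraph V) : SimpleGraph (V ⊕ G.edgeSet) where
  Adj x y :=
    match x, y with
    | .inl u, .inl v => Gᶜ.Adj u v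
    | .inl u, .inr e => u ∈ (e : Sym2 V)
    | .inr e, .inl u => u ∈ (e : Sym2 V)
    | .inr _, .inr _ => False
  symm := ⟨by
    rintro (u | e) (v | f) h
    · exact h.symm
    · exact h
    · exact h
    · exact h⟩
  loopless := ⟨by
    rintro (u | e) h
    · exact Gᶜ.irrefl h
    · exact h⟩

instance {V : Type*} [DecidableEq V] (G : SimpleGraph V) [DecidableRel G.Adj] :
    DecidableRel (centralGraph G).Adj := fun x y =>
  match x, y with
  | .inl u, .inl v => inferInstanceAs (Decidable (Gᶜ.Adj u v))
  | .inl u, .inr e => inferInstanceAs (Decidable (u ∈ (e : Sym2 V)))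
  | .inr e, .inl u => inferInstanceAs (Decidable (u ∈ (e : Sym2 V)))
  | .inr _, .inr _ => inferInstanceAs (Decidable False)

/-- A total coloring is a map `f` on vertices (`Sum.inl`) and edges (`Sum.inr`). It is proper if
adjacent vertices, distinct edges with a common end, and a vertex and an edge incident with it
always receive different colors. -/
structure IsProperTotalColoring {W α : Type*} (H : SimpleGraph W) (f : W ⊕ H.edgeSet → α) :
    Prop where
  vertex : ∀ u v : W, H.Adj u v → f (.inl u) ≠ f (.inl v)
  edge : ∀ e e' : H.edgeSet, e ≠ e' → (∃ v : W, v ∈ (e : Sym2 W) ∧ v ∈ (e' : Sym2 W)) →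
    f (.inr e) ≠ f (.inr e')
  incident : ∀ (v : W) (e : H.edgeSet), v ∈ (e : Sym2 W) → f (.inl v) ≠ f (.inr e)

/-- The automorphism `φ` of `H` preserves the total coloring `f`. -/
def PreservesTotalColoring {W α : Type*} {H : SimpleGraph W} (φ : H ≃g H)
    (f : W ⊕ H.edgeSet → α) : Prop :=
  (∀ v : W, f (.inl (φ v)) = f (.inl v)) ∧
    ∀ e : H.edgeSet, f (.inr (φ.mapEdgeSet e)) = f (.inr e)

/-- The total chromatic number `χ''(H)`: the least `k` such that `H` has a proper total coloring
with colors from a set of size `k`. -/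
noncomputable def totalChromaticNumber {W : Type*} (H : SimpleGraph W) : ℕ :=
  sInf {k : ℕ | ∃ f : W ⊕ H.edgeSet → Fin k, H.IsProperTotalColoring f}

/-- The total distinguishing chromatic number `χ''_D(H)`: the least `k` such that `H` has a proper
total coloring, with colors from a set of size `k`, that is preserved only by the identity. -/
noncomputable def totalDistinguishingChromaticNumber {W : Type*} (H : SimpleGraph W) : ℕ :=
  sInf {k : ℕ | ∃ f : W ⊕ H.edgeSet → Fin k, H.IsProperTotalColoring f ∧
    ∀ φ : H ≃g H, PreservesTotalColoring φ f → φ = Iso.refl}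

/-- `H` is of Type `j` if `χ''(H) = Δ(H) + j`. -/
def IsOfType {W : Type*} [Fintype W] (H : SimpleGraph W) [DecidableRel H.Adj] (j : ℕ) : Prop :=
  H.totalChromaticNumber = H.maxDegree + j

end SimpleGraph

/-! ### Half-edge colorings from lists: removing conflicts -/

namespace SimpleGraph

variable {V : Type*} {α : Type*}

/-! Old vertices have degree `n - 1` in the central graph, which forces at least `n` colors. The
task is to find a proper total coloring with `n` colors whose old vertices are pairwise differently
colored. Such a coloring is automatically distinguishing: an automorphism preserving it respects
degrees, so it maps old vertices to old vertices and fixes each of them, and a subdividing vertex is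
determined by its two neighbors.

It suffices to totally color the complement of `G` with `n` colors, injectively on vertices
(`Connected.centralGraph_chromaticNumbers`). Each vertex then has at least as many free colors as
half-edges, that is, edges to subdividing vertices. The obstacle is a conflict: an edge of `G` whose
halves agree. Take the fewest conflicts possible. A conflict of color `x` can be moved along walks,
and minimality forces every edge of `G` to carry `x` on some half. Each vertex has at most one
half-edge of color `x`, and the conflict spends two on one edge, so `G` has fewer than `n` edges; a
connected regular graph with `n ≥ 5` has at least `n`. Subdividing vertices come last: each avoids
four colors.

For odd `n`, label vertices by `ZMod n`, color vertices by `2 * l v` and pairs by `l u + l v`. For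
even `n`, use the nonzero elements of `ZMod (n + 1)`; now pairs with sum `0` need another color.
Give opposite labels to the ends of the edges of a maximum matching, as these pairs are not edges of
the complement, and pair off the unmatched vertices arbitrarily. For such a pair `u`, `v` arrange a
neighbor `a` of `u` with label `-2 * l u`. The color `l v = l u + l a` is free at `u`, since `a` is
a neighbor in `G`, and free at `v`, since no vertex has label `0`. Hall's theorem puts the vertices
`a` in distinct matched pairs, and a maximality argument in the cyclic group supplies the labels. -/

/-- `f` assigns to the half-edges at each vertex `i` distinct elements of `L i`. -/
def IsHalfEdgeColoring (G : SimpleGraph V) (L : V → Set α) (f : V → V → α) : Prop :=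
  (∀ i, Set.InjOn (f i) (G.neighborSet i)) ∧ ∀ i j, G.Adj i j → f i j ∈ L i

open Classical in
/-- The darts whose two half-edges have the same color. -/
noncomputable def halfEdgeConflicts [Fintype V] (G : SimpleGraph V) (f : V → V → α) :
    Finset (V × V) :=
  Finset.univ.filter fun p => G.Adj p.1 p.2 ∧ f p.1 p.2 = f p.2 p.1

lemma mem_halfEdgeConflicts [Fintype V] {G : SimpleGraph V} {f : V → V → α} {p : V × V} :
    p ∈ G.halfEdgeConflicts f ↔ G.Adj p.1 p.2 ∧ f p.1 p.2 = f p.2 p.1 := by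
  simp [halfEdgeConflicts]

/-- Exchange the colors of the half-edges at `i` towards `j` and `k`. -/
def swapHalfEdges [DecidableEq V] (f : V → V → α) (i j k : V) : V → V → α :=
  Function.update f i (f i ∘ Equiv.swap j k)

section swap

variable [DecidableEq V] {G : SimpleGraph V} {L : V → Set α} {f : V → V → α} {i j k : V}

lemma swapHalfEdges_self (b : V) : swapHalfEdges f i j k i b = f i (Equiv.swap j k b) := by
  simp [swapHalfEdges]

lemma swapHalfEdges_of_ne {a : V} (h : a ≠ i) (b : V) : swapHalfEdges f i j k a b = f a b := by
  simp [swapHalfEdges, h]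

lemma IsHalfEdgeColoring.swap (hf : G.IsHalfEdgeColoring L f) (hj : G.Adj i j)
    (hk : G.Adj i k) : G.IsHalfEdgeColoring L (swapHalfEdges f i j k) := by
  have key : ∀ b, G.Adj i b → G.Adj i (Equiv.swap j k b) := by
    intro b hb
    rw [Equiv.swap_apply_def]
    split_ifs <;> assumption
  refine ⟨fun a => ?_, fun a b hab => ?_⟩
  · by_cases ha : a = i
    · subst ha
      intro b hb b' hb' h
      rw [swapHalfEdges_self, swapHalfEdges_self] at h
      exact (Equiv.swap j k).injective (hf.1 a (key b hb) (key b' hb') h)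
    · intro b hb b' hb' h
      rw [swapHalfEdges_of_ne ha, swapHalfEdges_of_ne ha] at h
      exact hf.1 a hb hb' h
  · by_cases ha : a = i
    · subst ha
      rw [swapHalfEdges_self]
      exact hf.2 _ _ (key b hab)
    · rw [swapHalfEdges_of_ne ha]
      exact hf.2 a b hab

/-- Away from the half-edge towards `k`, exchanging colors at one end of a conflict creates no
conflict. -/
lemma IsHalfEdgeColoring.conflict_of_swap (hf : G.IsHalfEdgeColoring L f) (hj : G.Adj i j)
    (hk : G.Adj i k) (hjk : j ≠ k) (hc : f i j = f j i) {b : V} (hb : G.Adj i b) (hbk : b ≠ k)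
    (h : swapHalfEdges f i j k i b = swapHalfEdges f i j k b i) : f i b = f b i ∧ b ≠ j := by
  rw [swapHalfEdges_self, swapHalfEdges_of_ne hb.ne'] at h
  by_cases hbj : b = j
  · subst hbj
    rw [Equiv.swap_apply_left, ← hc] at h
    exact absurd (hf.1 i hk hj h).symm hjk
  · rw [Equiv.swap_apply_of_ne_of_ne hbj hbk] at h
    exact ⟨h, hbj⟩

variable [Fintype V]

lemma IsHalfEdgeColoring.conflicts_swap_subset (hf : G.IsHalfEdgeColoring L f) (hj : G.Adj i j)
    (hk : G.Adj i k) (hjk : j ≠ k) (hc : f i j = f j i) {p : V × V}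
    (hp : p ∈ G.halfEdgeConflicts (swapHalfEdges f i j k)) :
    (p = (i, k) ∨ p = (k, i)) ∨ (p ∈ G.halfEdgeConflicts f ∧ p ≠ (i, j) ∧ p ≠ (j, i)) := by
  obtain ⟨a, b⟩ := p
  rw [mem_halfEdgeConflicts] at hp ⊢
  obtain ⟨hab, h⟩ := hp
  simp only at hab h ⊢
  by_cases ha : a = i
  · subst ha
    by_cases hb : b = k
    · exact .inl (.inl (by rw [hb]))
    · obtain ⟨h1, h2⟩ := hf.conflict_of_swap hj hk hjk hc hab hb h
      exact .inr ⟨⟨hab, h1⟩, by simp [h2], by simp [hj.ne]⟩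
  · by_cases hb : b = i
    · subst hb
      by_cases hak : a = k
      · exact .inl (.inr (by rw [hak]))
      · obtain ⟨h1, h2⟩ := hf.conflict_of_swap hj hk hjk hc hab.symm hak h.symm
        exact .inr ⟨⟨hab, h1.symm⟩, by simp [ha], by simp [h2]⟩
    · rw [swapHalfEdges_of_ne ha, swapHalfEdges_of_ne hb] at h
      exact .inr ⟨⟨hab, h⟩, by simp [ha], by simp [hb]⟩

/-- A half-edge coloring with the least possible number of conflicts. -/
def IsMinHalfEdgeColoring (G : SimpleGraph V) (L : V → Set α) (f : V → V → α) : Prop :=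
  G.IsHalfEdgeColoring L f ∧ ∀ f', G.IsHalfEdgeColoring L f' →
    (G.halfEdgeConflicts f).card ≤ (G.halfEdgeConflicts f').card

/-- Otherwise the swap at `i` towards `j` and `k` destroys the conflict on `ij` and creates none on
`ik`, contradicting minimality. -/
lemma IsMinHalfEdgeColoring.eq_of_conflict (hf : G.IsMinHalfEdgeColoring L f) (hj : G.Adj i j)
    (hk : G.Adj i k) (hc : f i j = f j i) : f k i = f i j := by
  by_contra hne
  have hjk : j ≠ k := by
    rintro rfl
    exact hne hc.symm
  refine absurd (hf.2 _ (hf.1.swap hj hk)) (not_le.2 (Finset.card_lt_card ?_))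
  have hik : ¬ swapHalfEdges f i j k i k = swapHalfEdges f i j k k i := by
    rw [swapHalfEdges_self, swapHalfEdges_of_ne hk.ne', Equiv.swap_apply_right]
    exact fun h => hne h.symm
  rw [Finset.ssubset_iff_of_subset]
  · refine ⟨(i, j), mem_halfEdgeConflicts.2 ⟨hj, hc⟩, fun h => ?_⟩
    rcases hf.1.conflicts_swap_subset hj hk hjk hc h with (h' | h') | h'
    · simp [hjk] at h'
    · simp [hk.ne] at h'
    · exact h'.2.1 rfl
  · intro p hp
    rcases hf.1.conflicts_swap_subset hj hk hjk hc hp with (rfl | rfl) | h'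
    · exact absurd (mem_halfEdgeConflicts.1 hp).2 hik
    · exact absurd (mem_halfEdgeConflicts.1 hp).2.symm hik
    · exact h'.1

/-- The swap trades the conflict on `ij` for at most one on `ik`, so the number of conflicts does
not grow. -/
lemma IsMinHalfEdgeColoring.swap (hf : G.IsMinHalfEdgeColoring L f) (hj : G.Adj i j)
    (hk : G.Adj i k) (hjk : j ≠ k) (hc : f i j = f j i) :
    G.IsMinHalfEdgeColoring L (swapHalfEdges f i j k) := by
  refine ⟨hf.1.swap hj hk, fun f' hf' => le_trans ?_ (hf.2 f' hf')⟩
  have hij : (i, j) ∈ G.halfEdgeConflicts f := mem_halfEdgeConflicts.2 ⟨hj, hc⟩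
  have hji : (j, i) ∈ (G.halfEdgeConflicts f).erase (i, j) :=
    Finset.mem_erase.2 ⟨by simp [hj.ne'], mem_halfEdgeConflicts.2 ⟨hj.symm, hc.symm⟩⟩
  have hsub : G.halfEdgeConflicts (swapHalfEdges f i j k) ⊆
      insert (i, k) (insert (k, i) (((G.halfEdgeConflicts f).erase (i, j)).erase (j, i))) := by
    intro p hp
    rcases hf.1.conflicts_swap_subset hj hk hjk hc hp with (rfl | rfl) | ⟨h1, h2, h3⟩ <;>
      simp [*]
  have h1 := Finset.card_le_card hsub
  have h2 := Finset.card_insert_le (i, k)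
    (insert (k, i) (((G.halfEdgeConflicts f).erase (i, j)).erase (j, i)))
  have h3 := Finset.card_insert_le (k, i) (((G.halfEdgeConflicts f).erase (i, j)).erase (j, i))
  have h4 := Finset.card_erase_add_one hji
  have h5 := Finset.card_erase_add_one hij
  omega

/-- A conflict of color `x` can be moved along a walk without changing the set of edges that
carry the color `x`. -/
lemma IsMinHalfEdgeColoring.exists_conflict_at {x : α} {v w : V} (p : G.Walk v w) :
    ∀ f : V → V → α, G.IsMinHalfEdgeColoring L f →
      (∃ j, G.Adj v j ∧ f v j = x ∧ f j v = x) →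
      ∃ f', G.IsMinHalfEdgeColoring L f' ∧ (∃ j, G.Adj w j ∧ f' w j = x ∧ f' j w = x) ∧
        ∀ a b, G.Adj a b → f' a b = x → f a b = x ∨ f b a = x := by
  induction p with
  | nil => exact fun f hf h => ⟨f, hf, h, fun a b _ hab => .inl hab⟩
  | @cons v k w hvk p ih =>
    rintro f hf ⟨j, hj, h1, h2⟩
    -- By minimality the other half of `vk` already has color `x`, so swapping at `v` moves the
    -- conflict from `vj` to `vk`.
    have hkv : f k v = x := (hf.eq_of_conflict hj hvk (h1.trans h2.symm)).trans h1
    by_cases hjk : j = k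
    · subst hjk
      exact ih f hf ⟨v, hj.symm, h2, h1⟩
    obtain ⟨f', hf', hw, hx⟩ := ih _ (hf.swap hj hvk hjk (h1.trans h2.symm))
      ⟨v, hvk.symm, by rw [swapHalfEdges_of_ne hvk.ne', hkv],
        by rw [swapHalfEdges_self, Equiv.swap_apply_right, h1]⟩
    have key : ∀ a b, G.Adj a b → swapHalfEdges f v j k a b = x → f a b = x ∨ f b a = x := by
      intro a b hab h
      by_cases ha : a = v
      · subst ha
        by_cases hbj : b = j
        · exact .inr (hbj ▸ h2)
        · by_cases hbk : b = k
          · exact .inr (hbk ▸ hkv)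
          · rw [swapHalfEdges_self, Equiv.swap_apply_of_ne_of_ne hbj hbk] at h
            exact .inl h
      · rw [swapHalfEdges_of_ne ha] at h
        exact .inl h
    refine ⟨f', hf', hw, fun a b hab h => ?_⟩
    rcases hx a b hab h with h | h
    · exact key a b hab h
    · exact (key b a hab.symm h).symm

end swap

/-- In a connected graph that is not a tree, the half-edges at each vertex can be colored with
distinct colors from arbitrary sufficiently long lists such that the two halves of every edge
get different colors. -/
theorem Connected.exists_halfEdgeColoring [Fintype V] [DecidableEq V] {G : SimpleGraph V}
    [DecidableRel G.Adj] (hconn : G.Connected) (hcard : Fintype.card V ≤ G.edgeFinset.card)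
    {L : V → Set α} (hex : ∃ g, G.IsHalfEdgeColoring L g) :
    ∃ f, G.IsHalfEdgeColoring L f ∧ ∀ i j, G.Adj i j → f i j ≠ f j i := by
  classical
  obtain ⟨f, hf, hmin⟩ := (measure fun f : V → V → α => (G.halfEdgeConflicts f).card).wf.has_min
    {f | G.IsHalfEdgeColoring L f} hex
  have hf' : G.IsMinHalfEdgeColoring L f := ⟨hf, fun f' h' => not_lt.1 (hmin f' h')⟩
  refine ⟨f, hf, fun i j hij hc => ?_⟩
  -- Move the conflict to `a`: minimality then puts the color on the half of `ab` at `b`, and edges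
  -- carrying the color after the move carried it before.
  have hcover : ∀ a b, G.Adj a b → f a b = f i j ∨ f b a = f i j := by
    intro a b hab
    obtain ⟨p⟩ := hconn.preconnected i a
    obtain ⟨f', hmin', ⟨k, hak, h1, h2⟩, hx⟩ :=
      IsMinHalfEdgeColoring.exists_conflict_at p f hf' ⟨j, hij, rfl, hc.symm⟩
    have := hmin'.eq_of_conflict hak hab (h1.trans h2.symm)
    exact (hx b a hab.symm (this.trans h1)).symm
  let A : Finset (V × V) := Finset.univ.filter fun p => G.Adj p.1 p.2 ∧ f p.1 p.2 = f i j
  have hA : A.card ≤ Fintype.card V := by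
    refine Finset.card_le_card_of_injOn Prod.fst (fun _ _ => Finset.mem_coe.2 (Finset.mem_univ _)) ?_
    rintro ⟨a, b⟩ h ⟨a', b'⟩ h' hfst
    simp only [A, Finset.coe_filter, Finset.mem_univ, true_and, Set.mem_ofPred_eq] at h h' hfst
    subst hfst
    rw [hf.1 a h.1 h'.1 (h.2.trans h'.2.symm)]
  have hijA : (i, j) ∈ A := by simp [A, hij]
  -- The edge `ij` is counted twice in `A`, so `(i, j)` can be dropped; this saving of one gives the
  -- contradiction.
  have hE : G.edgeFinset ⊆ (A.erase (i, j)).image fun p => s(p.1, p.2) := by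
    intro z hz
    induction z with | _ a b =>
    have hab : G.Adj a b := by simpa using hz
    rw [Finset.mem_image]
    by_cases h : (a, b) ∈ A.erase (i, j)
    · exact ⟨(a, b), h, rfl⟩
    · refine ⟨(b, a), ?_, Sym2.eq_swap⟩
      rw [Finset.mem_erase, not_and_or, not_not] at h
      rcases h with h | h
      · obtain ⟨rfl, rfl⟩ := Prod.mk.inj h
        simp [A, hij.symm, hc, hij.ne']
      · have h2 : f a b ≠ f i j := fun h' => h (by simp [A, hab, h'])
        have h3 := (hcover a b hab).resolve_left h2
        refine Finset.mem_erase.2 ⟨?_, by simp [A, hab.symm, h3]⟩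
        rintro h'
        obtain ⟨rfl, rfl⟩ := Prod.mk.inj h'
        exact h2 hc.symm
  have h1 := (Finset.card_le_card hE).trans Finset.card_image_le
  have h2 := Finset.card_erase_add_one hijA
  omega

end SimpleGraph

/-! ### Degrees in the central graph and the lower bound -/

namespace SimpleGraph

variable {V : Type*}

section adj

variable {G : SimpleGraph V}

@[simp] lemma centralGraph_adj_inl_inl {u v : V} :
    G.centralGraph.Adj (.inl u) (.inl v) ↔ Gᶜ.Adj u v := Iff.rfl

@[simp] lemma centralGraph_adj_inl_inr {u : V} {e : G.edgeSet} :
    G.centralGraph.Adj (.inl u) (.inr e) ↔ u ∈ (e : Sym2 V) := Iff.rfl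

@[simp] lemma centralGraph_adj_inr_inl {u : V} {e : G.edgeSet} :
    G.centralGraph.Adj (.inr e) (.inl u) ↔ u ∈ (e : Sym2 V) := Iff.rfl

@[simp] lemma not_centralGraph_adj_inr_inr {e e' : G.edgeSet} :
    ¬ G.centralGraph.Adj (.inr e) (.inr e') := id

end adj

section degree

variable [Fintype V] [DecidableEq V] (G : SimpleGraph V) [DecidableRel G.Adj]

lemma centralGraph_degree_inl (v : V) :
    G.centralGraph.degree (.inl v) = Fintype.card V - 1 := by
  -- Every other vertex `j` accounts for exactly one neighbor of `v`: the vertex subdividing `vj`,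
  -- or `j` itself.
  let ψ : V → V ⊕ G.edgeSet := fun j =>
    if h : G.Adj v j then .inr ⟨s(v, j), h⟩ else .inl j
  have hψ : G.centralGraph.neighborFinset (.inl v) = (Finset.univ.erase v).image ψ := by
    ext x
    rw [mem_neighborFinset, Finset.mem_image]
    constructor
    · rcases x with u | ⟨e, he⟩
      · intro h
        rw [centralGraph_adj_inl_inl, compl_adj] at h
        exact ⟨u, by simp [h.1.symm], by simp [ψ, h.2]⟩
      · intro h
        obtain ⟨u, rfl⟩ := Sym2.mem_iff_exists.1 (centralGraph_adj_inl_inr.1 h)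
        have h' : G.Adj v u := he
        exact ⟨u, by simp [h'.ne'], by simp [ψ, h']⟩
    · rintro ⟨u, hu, rfl⟩
      by_cases h : G.Adj v u
      · simp [ψ, h]
      · simp only [Finset.mem_erase, Finset.mem_univ, and_true] at hu
        simp [ψ, h, Ne.symm hu]
  rw [← card_neighborFinset_eq_degree, hψ, Finset.card_image_of_injOn,
    Finset.card_erase_of_mem (Finset.mem_univ v), Finset.card_univ]
  intro a ha b hb hab
  by_cases h : G.Adj v a <;> by_cases h' : G.Adj v b <;> simp [ψ, h, h'] at hab
  · exact Sym2.congr_right.1 (Subtype.ext_iff.1 hab)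
  · exact hab

lemma centralGraph_degree_inr_le (e : G.edgeSet) : G.centralGraph.degree (.inr e) ≤ 2 := by
  obtain ⟨e, he⟩ := e
  induction e with | _ a b =>
  have hsub : G.centralGraph.neighborFinset (.inr ⟨s(a, b), he⟩) ⊆ {.inl a, .inl b} := by
    intro x hx
    rw [mem_neighborFinset] at hx
    rcases x with u | e'
    · simpa using hx
    · exact absurd hx not_centralGraph_adj_inr_inr
  rw [← card_neighborFinset_eq_degree]
  exact (Finset.card_le_card hsub).trans Finset.card_le_two

lemma centralGraph_maxDegree (hV : 3 ≤ Fintype.card V) :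
    G.centralGraph.maxDegree = Fintype.card V - 1 := by
  refine le_antisymm (maxDegree_le_of_forall_degree_le _ _ ?_) ?_
  · rintro (v | e)
    · exact (G.centralGraph_degree_inl v).le
    · exact (G.centralGraph_degree_inr_le e).trans (by omega)
  · have : Nonempty V := Fintype.card_pos_iff.1 (by omega)
    obtain ⟨v⟩ := this
    rw [← G.centralGraph_degree_inl v]
    exact degree_le_maxDegree _ _

end degree

/-- A proper total coloring uses more colors than any degree. -/
lemma IsProperTotalColoring.degree_lt_card {W α : Type*} [Fintype α] {H : SimpleGraph W}
    {f : W ⊕ H.edgeSet → α} (hf : H.IsProperTotalColoring f) (v : W)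
    [Fintype (H.neighborSet v)] : H.degree v < Fintype.card α := by
  classical
  let ψ : Option (H.neighborSet v) → α := fun o => o.elim (f (.inl v))
    fun w => f (.inr ⟨s(v, w), w.2⟩)
  have hψ : Function.Injective ψ := by
    rintro (_ | a) (_ | b) h
    · rfl
    · exact absurd h (hf.incident v ⟨s(v, b), b.2⟩ (by simp))
    · exact absurd h.symm (hf.incident v ⟨s(v, a), a.2⟩ (by simp))
    · by_contra hab
      refine hf.edge ⟨s(v, a), a.2⟩ ⟨s(v, b), b.2⟩ (fun h' => hab ?_) ⟨v, by simp, by simp⟩ h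
      rw [Subtype.ext (Sym2.congr_right.1 (Subtype.ext_iff.1 h'))]
  have := Fintype.card_le_of_injective ψ hψ
  rw [Fintype.card_option, card_neighborSet_eq_degree] at this
  omega

/-! ### Extending a total coloring of the complement to the central graph -/

section extension

variable {C : Type*}

/-- The color of the half-edge of `z` at `u`, if `F u v` is the color of the half-edge of `s(u, v)`
at `u`. -/
noncomputable def halfEdgeColor (F : V → V → C) (u : V) (z : Sym2 V) : C :=
  -- `F u u` is a default value for pairs not containing `u`.
  open Classical in if h : ∃ v, z = s(u, v) then F u h.choose else F u u

lemma halfEdgeColor_mk (F : V → V → C) (u v : V) : halfEdgeColor F u s(u, v) = F u v := by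
  have h : ∃ w, s(u, v) = s(u, w) := ⟨v, rfl⟩
  rw [halfEdgeColor, dif_pos h, ← Sym2.congr_right.1 h.choose_spec]

/-- The coloring of the pairs of vertices of the central graph given by the color `e u v` of a
pair of old vertices and the color `F u v` of the half-edge of `s(u, v)` at `u`. -/
noncomputable def centralPairColor {E : Set (Sym2 V)} (e F : V → V → C) (c₀ : C) :
    V ⊕ E → V ⊕ E → C
  | .inl u, .inl v => e u v
  | .inl u, .inr z => halfEdgeColor F u z
  | .inr z, .inl u => halfEdgeColor F u z
  | .inr _, .inr _ => c₀

lemma centralPairColor_comm {E : Set (Sym2 V)} {e : V → V → C} (he : ∀ u v, e u v = e v u)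
    (F : V → V → C) (c₀ : C) (x y : V ⊕ E) :
    centralPairColor e F c₀ x y = centralPairColor e F c₀ y x := by
  rcases x with u | z <;> rcases y with v | z' <;> simp [centralPairColor, he]

variable [Fintype V] [DecidableEq V] {G : SimpleGraph V} [DecidableRel G.Adj] [Fintype C]

/-- A total coloring of the complement of a connected graph which is not a tree, with as many
colors as there are vertices, can be completed at the half-edges of the central graph. -/
lemma Connected.exists_dartColoring (hconn : G.Connected)
    (hE : Fintype.card V ≤ G.edgeFinset.card) (hC : Fintype.card C = Fintype.card V)
    {c : V → C} {e : V → V → C} (hinc : ∀ u v, Gᶜ.Adj u v → e u v ≠ c u)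
    (hedge : ∀ u v w, Gᶜ.Adj u v → Gᶜ.Adj u w → v ≠ w → e u v ≠ e u w) :
    ∃ F : V → V → C, (∀ u v, Gᶜ.Adj u v → F u v = e u v) ∧
      (∀ u v, G.Adj u v → F u v ≠ F v u) ∧ (∀ u v, u ≠ v → F u v ≠ c u) ∧
      ∀ u v w, u ≠ v → u ≠ w → v ≠ w → F u v ≠ F u w := by
  classical
  -- The colors already used at `i`: at most `1 + (n - 1 - deg i)`, leaving at least `deg i` for the
  -- half-edges.
  let D : V → Finset C := fun i => insert (c i) ((Gᶜ.neighborFinset i).image (e i))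
  have hD : ∀ i, G.degree i ≤ (D i)ᶜ.card := by
    intro i
    have h1 : (D i).card ≤ Gᶜ.degree i + 1 := by
      rw [← card_neighborFinset_eq_degree]
      exact (Finset.card_insert_le _ _).trans (Nat.add_le_add_right Finset.card_image_le 1)
    have h2 := G.degree_compl i
    have h3 := G.degree_lt_card_verts i
    rw [Finset.card_compl, hC]
    omega
  have hne : Nonempty C := by
    obtain ⟨v⟩ := hconn.nonempty
    exact ⟨c v⟩
  have hg : ∀ i, ∃ g : V → C, Set.InjOn g (G.neighborSet i) ∧
      ∀ j, G.Adj i j → g j ∈ ((D i)ᶜ : Finset C) := by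
    intro i
    have h := hD i
    rw [← card_neighborFinset_eq_degree] at h
    obtain ⟨g, hg1, hg2⟩ := (G.neighborFinset i).finite_toSet.exists_injOn_of_encard_le
      (t := (((D i)ᶜ : Finset C) : Set C)) (by
        rw [Set.encard_coe_eq_coe_finsetCard, Set.encard_coe_eq_coe_finsetCard]
        exact_mod_cast h)
    rw [coe_neighborFinset] at hg1 hg2
    exact ⟨g, hg2, fun j hj => hg1 hj⟩
  choose g hg1 hg2 using hg
  obtain ⟨f, hf, hne⟩ := hconn.exists_halfEdgeColoring hE (L := fun i => ((D i)ᶜ : Finset C))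
    ⟨g, hg1, fun i j hij => hg2 i j hij⟩
  have hf1 : ∀ i j, G.Adj i j → f i j ≠ c i := by
    intro i j hij h
    have := hf.2 i j hij
    simp [D, h] at this
  have hf2 : ∀ i j k, G.Adj i j → Gᶜ.Adj i k → f i j ≠ e i k := by
    intro i j k hij hik h
    have := hf.2 i j hij
    simp only [D, Finset.coe_compl, Set.mem_compl_iff, Finset.mem_coe, Finset.mem_insert,
      Finset.mem_image, mem_neighborFinset, not_or, not_exists, not_and] at this
    exact this.2 k hik h.symm
  have hcompl : ∀ i j, i ≠ j → ¬ G.Adj i j → Gᶜ.Adj i j := fun i j h h' =>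
    (G.compl_adj i j).2 ⟨h, h'⟩
  refine ⟨fun i j => if G.Adj i j then f i j else e i j, fun u v h => ?_, fun u v h => ?_,
    fun u v h => ?_, fun u v w huv huw hvw => ?_⟩
  · simp [((G.compl_adj u v).1 h).2]
  · simpa [h, h.symm] using hne u v h
  · by_cases h' : G.Adj u v
    · simpa [h'] using hf1 u v h'
    · simpa [h'] using hinc u v (hcompl u v h h')
  · by_cases h1 : G.Adj u v <;> by_cases h2 : G.Adj u w <;> simp only [h1, h2, if_true, if_false]
    · exact fun h => hvw (hf.1 u h1 h2 h)
    · exact hf2 u v w h1 (hcompl u w huw h2)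
    · exact (hf2 u w v h2 (hcompl u v huv h1)).symm
    · exact hedge u v w (hcompl u v huv h1) (hcompl u w huw h2) hvw

/-- A total coloring of the complement of `G` with injective vertex colors extends to a total
coloring of the central graph of `G` that is preserved only by the identity. -/
theorem Connected.exists_distinguishing_totalColoring (hconn : G.Connected)
    (hE : Fintype.card V ≤ G.edgeFinset.card) (hV : 5 ≤ Fintype.card V)
    (hC : Fintype.card C = Fintype.card V)
    {c : V → C} (hc : Function.Injective c) {e : V → V → C} (hsymm : ∀ u v, e u v = e v u)
    (hinc : ∀ u v, Gᶜ.Adj u v → e u v ≠ c u)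
    (hedge : ∀ u v w, Gᶜ.Adj u v → Gᶜ.Adj u w → v ≠ w → e u v ≠ e u w) :
    ∃ f : (V ⊕ G.edgeSet) ⊕ G.centralGraph.edgeSet → C,
      G.centralGraph.IsProperTotalColoring f ∧
      ∀ φ : G.centralGraph ≃g G.centralGraph, PreservesTotalColoring φ f → φ = Iso.refl := by
  classical
  obtain ⟨F, hFe, hFne, hFc, hFF⟩ := hconn.exists_dartColoring hE hC hinc hedge
  obtain ⟨v₀⟩ := hconn.nonempty
  have hw : ∀ z : G.edgeSet, ∃ x : C, ∀ u ∈ (z : Sym2 V), x ≠ c u ∧ x ≠ halfEdgeColor F u z := by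
    rintro ⟨z, hz⟩
    induction z with | _ a b =>
    -- A subdividing vertex has two neighbors and two incident edges, so five colors suffice.
    have hlt : ({c a, c b, F a b, F b a} : Finset C).card < Fintype.card C :=
      Finset.card_le_four.trans_lt (by omega)
    obtain ⟨x, hx⟩ := Finset.exists_mem_notMem_of_card_lt_card
      (s := {c a, c b, F a b, F b a}) (t := Finset.univ) (by rwa [Finset.card_univ])
    simp only [Finset.mem_univ, Finset.mem_insert, Finset.mem_singleton, not_or, true_and] at hx
    refine ⟨x, fun u hu => ?_⟩
    rcases Sym2.mem_iff.1 hu with rfl | rfl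
    · rw [halfEdgeColor_mk]
      exact ⟨hx.1, hx.2.2.1⟩
    · have h : halfEdgeColor F u s(a, u) = F u a := by rw [Sym2.eq_swap, halfEdgeColor_mk]
      exact ⟨hx.2.1, h ▸ hx.2.2.2⟩
  choose w hw1 using hw
  -- `c v₀` is a default for two subdividing vertices, which are never adjacent.
  let ec : Sym2 (V ⊕ G.edgeSet) → C :=
    Sym2.lift ⟨centralPairColor e F (c v₀), centralPairColor_comm hsymm F (c v₀)⟩
  let f : (V ⊕ G.edgeSet) ⊕ G.centralGraph.edgeSet → C
    | .inl (.inl v) => c v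
    | .inl (.inr z) => w z
    | .inr z => ec z
  -- the edges at an old vertex have the colors `F u v`
  have hat : ∀ (u : V) (x : V ⊕ G.edgeSet), G.centralGraph.Adj (.inl u) x →
      ∃ v, u ≠ v ∧ ec s(.inl u, x) = F u v ∧ x = if h : G.Adj u v then .inr ⟨s(u, v), h⟩
        else .inl v := by
    rintro u (v | ⟨z, hz⟩) h
    · rw [centralGraph_adj_inl_inl] at h
      have h' := (G.compl_adj u v).1 h
      exact ⟨v, h'.1, (hFe u v h).symm, by simp [h'.2]⟩
    · obtain ⟨v, rfl⟩ := Sym2.mem_iff_exists.1 (centralGraph_adj_inl_inr.1 h)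
      have h' : G.Adj u v := hz
      exact ⟨v, h'.ne, halfEdgeColor_mk F u v, by simp [h']⟩
  refine ⟨f, ⟨?_, ?_, ?_⟩, ?_⟩
  · rintro (u | z) (v | z') h
    · exact fun h' => ((G.compl_adj u v).1 h).1 (hc h')
    · exact (hw1 z' u h).1.symm
    · exact (hw1 z v h).1
    · exact absurd h not_centralGraph_adj_inr_inr
  · rintro ⟨y, hy⟩ ⟨y', hy'⟩ hne ⟨v, hv, hv'⟩
    obtain ⟨x, rfl⟩ := Sym2.mem_iff_exists.1 hv
    obtain ⟨x', rfl⟩ := Sym2.mem_iff_exists.1 hv'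
    have hxx : x ≠ x' := fun h => hne (by subst h; rfl)
    rcases v with u | ⟨z, hz⟩
    · obtain ⟨a, ha, h1, rfl⟩ := hat u x hy
      obtain ⟨b, hb, h2, rfl⟩ := hat u x' hy'
      change ec _ ≠ ec _
      rw [h1, h2]
      exact hFF u a b ha hb fun h => hxx (by subst h; rfl)
    · rcases x with a | x
      swap
      · exact False.elim hy
      rcases x' with b | x'
      swap
      · exact False.elim hy'
      have ha : a ∈ z := hy
      have hb : b ∈ z := hy'
      have hab : a ≠ b := fun h => hxx (by rw [h])
      obtain rfl : z = s(a, b) := ((Sym2.mem_and_mem_iff hab).1 ⟨ha, hb⟩)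
      change halfEdgeColor F a s(a, b) ≠ halfEdgeColor F b s(a, b)
      rw [halfEdgeColor_mk, Sym2.eq_swap, halfEdgeColor_mk]
      exact hFne a b hz
  · rintro (u | z) ⟨y, hy⟩ hv
    · obtain ⟨x, rfl⟩ := Sym2.mem_iff_exists.1 hv
      obtain ⟨a, ha, h1, -⟩ := hat u x hy
      change c u ≠ ec _
      rw [h1]
      exact (hFc u a ha).symm
    · obtain ⟨x, rfl⟩ := Sym2.mem_iff_exists.1 hv
      rcases x with a | x
      · exact (hw1 z a hy).2
      · exact False.elim hy
  · intro φ hφ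
    -- Degree `n - 1 > 2` keeps the image among the old vertices, where colors are injective.
    have hinl : ∀ v, φ (.inl v) = .inl v := by
      intro v
      have h1 := hφ.1 (.inl v)
      have h2 : G.centralGraph.degree (φ (.inl v)) = _ := φ.degree_eq (.inl v)
      rw [centralGraph_degree_inl] at h2
      rcases h : φ (.inl v) with u | z
      · rw [h] at h1
        rw [hc h1]
      · rw [h] at h2
        have := G.centralGraph_degree_inr_le z
        omega
    ext x
    rcases x with v | ⟨z, hz⟩
    · exact hinl v
    · change φ _ = _
      induction z with | _ a b =>
      have ha : G.centralGraph.Adj (φ (.inl a)) (φ (.inr ⟨s(a, b), hz⟩)) :=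
        φ.map_adj_iff.2 (by simp)
      have hb : G.centralGraph.Adj (φ (.inl b)) (φ (.inr ⟨s(a, b), hz⟩)) :=
        φ.map_adj_iff.2 (by simp)
      rw [hinl] at ha hb
      rcases h : φ (.inr ⟨s(a, b), hz⟩) with u | ⟨z', hz'⟩
      · rw [← hinl u] at h
        exact absurd (φ.injective h) (by simp)
      · rw [h] at ha hb
        have hab : a ≠ b := G.ne_of_adj hz
        have h' : z' = s(a, b) := (Sym2.mem_and_mem_iff hab).1 ⟨ha, hb⟩
        subst h'
        rfl

end extension

/-- If the complement of `G` has a total coloring with injective vertex colors and as many colors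
as there are vertices, then both chromatic numbers of the central graph are one more than its
maximum degree. -/
theorem Connected.centralGraph_chromaticNumbers [Fintype V] [DecidableEq V] {G : SimpleGraph V}
    [DecidableRel G.Adj] {C : Type*} [Fintype C] (hconn : G.Connected)
    (hE : Fintype.card V ≤ G.edgeFinset.card) (hV : 5 ≤ Fintype.card V)
    (hC : Fintype.card C = Fintype.card V)
    {c : V → C} (hc : Function.Injective c) {e : V → V → C} (hsymm : ∀ u v, e u v = e v u)
    (hinc : ∀ u v, Gᶜ.Adj u v → e u v ≠ c u)
    (hedge : ∀ u v w, Gᶜ.Adj u v → Gᶜ.Adj u w → v ≠ w → e u v ≠ e u w) :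
    G.centralGraph.totalDistinguishingChromaticNumber = G.centralGraph.maxDegree + 1 ∧
      G.centralGraph.IsOfType 1 := by
  have hcard : G.centralGraph.maxDegree + 1 = Fintype.card V := by
    rw [centralGraph_maxDegree G (by omega)]
    omega
  obtain ⟨v⟩ := hconn.nonempty
  have hlow : ∀ k (f : (V ⊕ G.edgeSet) ⊕ G.centralGraph.edgeSet → Fin k),
      G.centralGraph.IsProperTotalColoring f → Fintype.card V ≤ k := by
    intro k f hf
    have := hf.degree_lt_card (.inl v)
    rw [centralGraph_degree_inl, Fintype.card_fin] at this
    omega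
  obtain ⟨f, hf, hdist⟩ := hconn.exists_distinguishing_totalColoring hE hV hC hc hsymm hinc hedge
  let ε : C ≃ Fin (Fintype.card V) := Fintype.equivFinOfCardEq hC
  have hf' : G.centralGraph.IsProperTotalColoring (ε ∘ f) :=
    ⟨fun u v h h' => hf.vertex u v h (ε.injective h'),
      fun z z' h h1 h' => hf.edge z z' h h1 (ε.injective h'),
      fun u z h h' => hf.incident u z h (ε.injective h')⟩
  have hdist' : ∀ φ : G.centralGraph ≃g G.centralGraph,
      PreservesTotalColoring φ (ε ∘ f) → φ = Iso.refl := fun φ hφ =>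
    hdist φ ⟨fun v => ε.injective (hφ.1 v), fun z => ε.injective (hφ.2 z)⟩
  rw [IsOfType, hcard]
  constructor
  · refine le_antisymm (Nat.sInf_le ⟨_, hf', hdist'⟩) (le_csInf ⟨_, _, hf', hdist'⟩ ?_)
    rintro k ⟨f', h, -⟩
    exact hlow k f' h
  · refine le_antisymm (Nat.sInf_le ⟨_, hf'⟩) (le_csInf ⟨_, _, hf'⟩ ?_)
    rintro k ⟨f', h⟩
    exact hlow k f' h

end SimpleGraph

/-! ### Labels with disjoint negatives and doubles in an odd cyclic group -/

/-- Every odd cyclic group contains a set `I` of at least a sixth of the nonzero elements such that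
the elements `±i` and `±2i` with `i ∈ I` are distinct. -/
theorem ZMod.exists_finset_disjoint_doubles (m t : ℕ) (ht : 3 * t ≤ m) :
    ∃ I : Finset (ZMod (2 * m + 1)), t ≤ I.card ∧
      ∀ i ∈ I, ∀ j ∈ I, i ≠ -j ∧ i ≠ 2 * j ∧ i ≠ -(2 * j) := by
  classical
  let R : ZMod (2 * m + 1) → ZMod (2 * m + 1) → Prop := fun i j =>
    i ≠ -j ∧ i ≠ 2 * j ∧ i ≠ -(2 * j)
  obtain ⟨I, hI, hmax⟩ := Finset.exists_max_image
    ((Finset.univ : Finset (Finset (ZMod (2 * m + 1)))).filter fun I => ∀ i ∈ I, ∀ j ∈ I, R i j)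
    Finset.card ⟨∅, by simp⟩
  rw [Finset.mem_filter] at hI
  refine ⟨I, ?_, hI.2⟩
  have h2 : IsUnit (2 : ZMod (2 * m + 1)) := by
    have : IsUnit ((2 : ℕ) : ZMod (2 * m + 1)) := (ZMod.isUnit_iff_coprime _ _).2 (by simp)
    exact_mod_cast this
  obtain ⟨u, hu⟩ := h2
  -- If `I` is maximal, every `x` lies in `±I`, `±2I`, `±I/2` (the set `B`) or satisfies `3x = 0`:
  -- outside `B` it is compatible with all of `I`, and `3x ≠ 0` makes it compatible with itself.
  let T : Finset (ZMod (2 * m + 1)) := Finset.univ.filter fun x => 3 • x = 0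
  let B : Finset (ZMod (2 * m + 1)) :=
    ((I ∪ I.image fun j => -j) ∪ ((I.image fun j => 2 * j) ∪ I.image fun j => -(2 * j))) ∪
      ((I.image fun j => ↑u⁻¹ * j) ∪ I.image fun j => -(↑u⁻¹ * j))
  have hinv : ∀ x : ZMod (2 * m + 1), ↑u⁻¹ * (2 * x) = x := fun x => by
    rw [← hu, Units.inv_mul_cancel_left]
  have hcover : ∀ x, x ∈ B ∪ T := by
    intro x
    by_contra hx
    simp only [B, T, Finset.mem_union, Finset.mem_image, not_or, not_exists, not_and,
      Finset.mem_filter, Finset.mem_univ, true_and] at hx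
    obtain ⟨⟨⟨⟨hxI, hneg⟩, hdbl, hndbl⟩, hhalf, hnhalf⟩, h3⟩ := hx
    have hx0 : x ≠ 0 := by
      rintro rfl
      simp at h3
    have hself : R x x := by
      refine ⟨fun h => hx0 ?_, fun h => hx0 ?_, fun h => h3 ?_⟩
      · have h' : (2 : ZMod (2 * m + 1)) * x = 0 := by linear_combination h
        rw [← hinv x, h', mul_zero]
      · linear_combination -h
      · rw [nsmul_eq_mul]
        push_cast
        linear_combination h
    have hnew : ∀ i ∈ insert x I, ∀ j ∈ insert x I, R i j := by
      intro i hi j hj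
      rw [Finset.mem_insert] at hi hj
      rcases hi with rfl | hi <;> rcases hj with rfl | hj
      · exact hself
      · exact ⟨fun h => hneg j hj h.symm, fun h => hdbl j hj h.symm, fun h => hndbl j hj h.symm⟩
      · refine ⟨fun h => hneg i hi (by rw [h, neg_neg]), fun h => hhalf i hi (by rw [h, hinv]),
          fun h => hnhalf i hi (by rw [h, mul_neg, hinv, neg_neg])⟩
      · exact hI.2 i hi j hj
    have := hmax (insert x I) (Finset.mem_filter.2 ⟨Finset.mem_univ _, hnew⟩)
    rw [Finset.card_insert_of_notMem hxI] at this
    omega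
  have hB : B.card ≤ 6 * I.card := by
    have hi : ∀ f : ZMod (2 * m + 1) → ZMod (2 * m + 1), (I.image f).card ≤ I.card := fun f =>
      Finset.card_image_le
    refine (Finset.card_union_le _ _).trans ?_
    refine (Nat.add_le_add ((Finset.card_union_le _ _).trans (Nat.add_le_add
      ((Finset.card_union_le _ _).trans (Nat.add_le_add le_rfl (hi _)))
      ((Finset.card_union_le _ _).trans (Nat.add_le_add (hi _) (hi _)))))
      ((Finset.card_union_le _ _).trans (Nat.add_le_add (hi _) (hi _)))).trans ?_
    omega
  have hcard : 2 * m + 1 ≤ 6 * I.card + T.card := by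
    have h1 : (Finset.univ : Finset (ZMod (2 * m + 1))).card ≤ (B ∪ T).card :=
      Finset.card_le_card fun x _ => hcover x
    rw [Finset.card_univ, ZMod.card] at h1
    have := Finset.card_union_le B T
    omega
  have hT3 : T.card ≤ 3 := by
    have := IsAddCyclic.card_nsmul_eq_zero_le (α := ZMod (2 * m + 1)) (n := 3) (by norm_num)
    convert this using 2
  -- If `3 ∣ 2m + 1`, then `m ≡ 1` mod 3, so `3t ≤ m - 1` and the loss of three elements is
  -- affordable. Otherwise only `0` is lost.
  by_cases h3 : 3 ∣ 2 * m + 1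
  · omega
  · have hT1 : T ⊆ {0} := by
      intro x hx
      simp only [T, Finset.mem_filter, Finset.mem_univ, true_and, nsmul_eq_mul] at hx
      have h3u : IsUnit ((3 : ℕ) : ZMod (2 * m + 1)) := (ZMod.isUnit_iff_coprime _ _).2
        (((Nat.Prime.coprime_iff_not_dvd Nat.prime_three).2 h3))
      rw [Finset.mem_singleton]
      exact (h3u.mul_right_eq_zero).1 hx
    have := Finset.card_le_card hT1
    rw [Finset.card_singleton] at this
    omega

/-! ### Equivariant bijections between fixed-point-free involutions -/

/-- Representatives of distinct orbits of size two parametrize the union of these orbits. -/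
lemma Function.Involutive.injective_orbitMap {ι V : Type*} {τ : V → V} (hτ : τ.Involutive) {Φ : ι → V}
    (hΦ : Function.Injective Φ) (hΦ' : ∀ i j, Φ i ≠ τ (Φ j)) :
    Function.Injective fun z : ι × Bool => if z.2 then τ (Φ z.1) else Φ z.1 := by
  rintro ⟨i, b⟩ ⟨j, b'⟩ hz
  cases b <;> cases b' <;> simp at hz
  · rw [hΦ hz]
  · exact absurd hz (hΦ' i j)
  · exact absurd hz.symm (hΦ' j i)
  · rw [hΦ (hτ.injective hz)]

section extend

variable {V S : Type*} [Fintype V] [Fintype S] {τ : V → V} {ν : S → S}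

/-- An equivariant injection between sets with fixed-point-free involutions extends from an
invariant subset. -/
theorem Function.Involutive.exists_equivariant_extension (hcard : Fintype.card V = Fintype.card S)
    (hτ : τ.Involutive) (hν : ν.Involutive) (hτ' : ∀ x, τ x ≠ x) (hν' : ∀ y, ν y ≠ y)
    (A : Finset V) (h : V → S) (hA : ∀ x ∈ A, τ x ∈ A) (hinj : Set.InjOn h A)
    (hequi : ∀ x ∈ A, h (τ x) = ν (h x)) :
    ∃ l : V → S, Function.Injective l ∧ (∀ x, l (τ x) = ν (l x)) ∧ ∀ x ∈ A, l x = h x := by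
  classical
  induction hk : Aᶜ.card using Nat.strong_induction_on generalizing A h with | _ k ih =>
  by_cases hall : ∀ x, x ∈ A
  · exact ⟨h, fun x y hxy => hinj (hall x) (hall y) hxy, fun x => hequi x (hall x),
      fun _ _ => rfl⟩
  push Not at hall
  obtain ⟨x, hx⟩ := hall
  have hlt : (A.image h).card < (Finset.univ : Finset S).card := by
    rw [Finset.card_univ, ← hcard]
    exact Finset.card_image_le.trans_lt (Finset.card_lt_univ_of_notMem hx)
  obtain ⟨y, -, hy⟩ := Finset.exists_mem_notMem_of_card_lt_card hlt
  have hyA : ∀ a ∈ A, h a ≠ y := fun a ha h' => hy (Finset.mem_image.2 ⟨a, ha, h'⟩)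
  -- The image of `A` is `ν`-invariant, so missing `y` it also misses `ν y`, and the orbit of `x`
  -- can be sent to that of `y`.
  have hνyA : ∀ a ∈ A, h a ≠ ν y := fun a ha h' =>
    hyA (τ a) (hA a ha) (by rw [hequi a ha, h', hν y])
  have hτx : τ x ∉ A := fun h' => hx (hτ x ▸ hA _ h')
  let h' : V → S := fun a => if a = x then y else if a = τ x then ν y else h a
  have h1 : h' x = y := by simp [h']
  have h2 : h' (τ x) = ν y := by simp [h', hτ' x]
  have h3 : ∀ a ∈ A, h' a = h a := by
    intro a ha
    have e1 : a ≠ x := fun h => hx (h ▸ ha)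
    have e2 : a ≠ τ x := fun h => hτx (h ▸ ha)
    simp [h', e1, e2]
  obtain ⟨l, hl1, hl2, hl3⟩ := ih (insert x (insert (τ x) A))ᶜ.card
    (by
      rw [← hk]
      refine Finset.card_lt_card ?_
      rw [Finset.compl_ssubset_compl]
      exact (Finset.ssubset_iff_of_subset fun a ha => by simp [ha]).2 ⟨x, by simp, hx⟩)
    (insert x (insert (τ x) A)) h'
    (by
      intro a ha
      rw [Finset.mem_insert, Finset.mem_insert] at ha ⊢
      rcases ha with rfl | rfl | ha
      · simp
      · simp [hτ x]
      · simp [hA a ha])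
    (by
      intro a ha b hb hab
      rw [Finset.mem_coe, Finset.mem_insert, Finset.mem_insert] at ha hb
      rcases ha with rfl | rfl | ha <;> rcases hb with rfl | rfl | hb
      · rfl
      · rw [h1, h2] at hab
        exact absurd hab.symm (hν' y)
      · rw [h1, h3 b hb] at hab
        exact absurd hab.symm (hyA b hb)
      · rw [h1, h2] at hab
        exact absurd hab (hν' y)
      · rfl
      · rw [h2, h3 b hb] at hab
        exact absurd hab.symm (hνyA b hb)
      · rw [h1, h3 a ha] at hab
        exact absurd hab (hyA a ha)
      · rw [h2, h3 a ha] at hab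
        exact absurd hab (hνyA a ha)
      · rw [h3 a ha, h3 b hb] at hab
        exact hinj ha hb hab)
    (by
      intro a ha
      rw [Finset.mem_insert, Finset.mem_insert] at ha
      rcases ha with rfl | rfl | ha
      · rw [h1, h2]
      · rw [hτ x, h1, h2, hν y]
      · rw [h3 a ha, h3 _ (hA a ha), hequi a ha])
    rfl
  exact ⟨l, hl1, hl2, fun a ha => by rw [hl3 a (by simp [ha]), h3 a ha]⟩

/-- A fixed-point-free involution can be identified with another one such that representatives of
some orbits of the first correspond to given representatives of orbits of the second. -/
theorem Function.Involutive.exists_equivariant_injective {ι : Type*} [Fintype ι]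
    (hcard : Fintype.card V = Fintype.card S)
    (hτ : τ.Involutive) (hν : ν.Involutive) (hτ' : ∀ x, τ x ≠ x) (hν' : ∀ y, ν y ≠ y)
    {Φ : ι → V} {Ψ : ι → S} (hΦ : Function.Injective Φ) (hΦ' : ∀ i j, Φ i ≠ τ (Φ j))
    (hΨ : Function.Injective Ψ) (hΨ' : ∀ i j, Ψ i ≠ ν (Ψ j)) :
    ∃ l : V → S, Function.Injective l ∧ (∀ x, l (τ x) = ν (l x)) ∧ ∀ i, l (Φ i) = Ψ i := by
  classical
  -- `Function.invFun` below needs a nonempty domain.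
  cases isEmpty_or_nonempty ι
  · obtain ⟨l, h1, h2, -⟩ := hτ.exists_equivariant_extension hcard hν hτ' hν' ∅
      (Fintype.equivOfCardEq hcard) (by simp) (by simp) (by simp)
    exact ⟨l, h1, h2, fun i => isEmptyElim i⟩
  let Φ₂ : ι × Bool → V := fun z => if z.2 then τ (Φ z.1) else Φ z.1
  let Ψ₂ : ι × Bool → S := fun z => if z.2 then ν (Ψ z.1) else Ψ z.1
  have hΦ₂ : Function.Injective Φ₂ := hτ.injective_orbitMap hΦ hΦ'
  have hτΦ : ∀ z, τ (Φ₂ z) = Φ₂ (z.1, !z.2) := by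
    rintro ⟨i, b⟩
    cases b <;> simp [Φ₂, hτ (Φ i)]
  have hνΨ : ∀ z, ν (Ψ₂ z) = Ψ₂ (z.1, !z.2) := by
    rintro ⟨i, b⟩
    cases b <;> simp [Ψ₂, hν (Ψ i)]
  let h : V → S := fun x => Ψ₂ (Function.invFun Φ₂ x)
  have hh : ∀ z, h (Φ₂ z) = Ψ₂ z := fun z => by
    simp only [h, Function.leftInverse_invFun hΦ₂ z]
  obtain ⟨l, h1, h2, h3⟩ := hτ.exists_equivariant_extension hcard hν hτ' hν'
    (Finset.univ.image Φ₂) h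
    (by
      intro x hx
      obtain ⟨z, -, rfl⟩ := Finset.mem_image.1 hx
      rw [hτΦ]
      exact Finset.mem_image_of_mem _ (Finset.mem_univ _))
    (by
      intro x hx y hy hxy
      obtain ⟨z, -, rfl⟩ := Finset.mem_image.1 (Finset.mem_coe.1 hx)
      obtain ⟨z', -, rfl⟩ := Finset.mem_image.1 (Finset.mem_coe.1 hy)
      rw [hh, hh] at hxy
      rw [show z = z' from hν.injective_orbitMap hΨ hΨ' hxy])
    (by
      intro x hx
      obtain ⟨z, -, rfl⟩ := Finset.mem_image.1 hx
      rw [hτΦ, hh, hh, hνΨ])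
  refine ⟨l, h1, h2, fun i => ?_⟩
  have := h3 (Φ₂ (i, false)) (Finset.mem_image_of_mem _ (Finset.mem_univ _))
  rw [hh] at this
  simpa [Φ₂, Ψ₂] using this

end extend

/-! ### Maximum matchings and Hall's theorem -/

namespace SimpleGraph

variable {V : Type*} (G : SimpleGraph V)

/-- The involution `μ` matches each vertex that it moves with one of its neighbors. -/
def IsMatchingMap (μ : V → V) : Prop :=
  μ.Involutive ∧ ∀ x, μ x ≠ x → G.Adj x (μ x)

variable {G} [Fintype V] [DecidableEq V] {μ : V → V}

/-- The vertices that are left unmatched by `μ`. -/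
def unmatched (μ : V → V) : Finset V := Finset.univ.filter fun x => μ x = x


lemma mem_unmatched {x : V} : x ∈ unmatched μ ↔ μ x = x := by simp [unmatched]

lemma IsMatchingMap.exists_add (hμ : G.IsMatchingMap μ) {u v : V} (huv : G.Adj u v)
    (hu : μ u = u) (hv : μ v = v) :
    ∃ μ', G.IsMatchingMap μ' ∧ (∀ x, x ≠ u → x ≠ v → μ' x = μ x) ∧
      (unmatched μ').card + 2 = (unmatched μ).card := by
  have hne := huv.ne
  have hinv := hμ.1
  have hmem : ∀ x, x ≠ u → x ≠ v → μ x ≠ u ∧ μ x ≠ v := by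
    intro x h1 h2
    exact ⟨fun h => h1 (by rw [← hinv x, h, hu]), fun h => h2 (by rw [← hinv x, h, hv])⟩
  let μ' : V → V := fun x => if x = u then v else if x = v then u else μ x
  have e1 : μ' u = v := by simp [μ']
  have e2 : μ' v = u := by simp [μ', hne.symm]
  have e3 : ∀ x, x ≠ u → x ≠ v → μ' x = μ x := fun x h1 h2 => by simp [μ', h1, h2]
  refine ⟨μ', ⟨fun x => ?_, fun x hx => ?_⟩, e3, ?_⟩
  · by_cases h1 : x = u
    · rw [h1, e1, e2]
    by_cases h2 : x = v
    · rw [h2, e2, e1]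
    rw [e3 x h1 h2, e3 _ (hmem x h1 h2).1 (hmem x h1 h2).2, hinv]
  · by_cases h1 : x = u
    · rw [h1, e1]
      exact huv
    by_cases h2 : x = v
    · rw [h2, e2]
      exact huv.symm
    rw [e3 x h1 h2] at hx ⊢
    exact hμ.2 x hx
  · have : unmatched μ' = ((unmatched μ).erase u).erase v := by
      ext x
      rw [Finset.mem_erase, Finset.mem_erase, mem_unmatched, mem_unmatched]
      by_cases h1 : x = u
      · simp [h1, e1, hne.symm]
      by_cases h2 : x = v
      · simp [h2, e2, hne]
      simp [e3 x h1 h2, h1, h2]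
    have huU : u ∈ unmatched μ := mem_unmatched.2 hu
    have hvU : v ∈ (unmatched μ).erase u := Finset.mem_erase.2 ⟨hne.symm, mem_unmatched.2 hv⟩
    have h1 := Finset.card_erase_add_one huU
    have h2 := Finset.card_erase_add_one hvU
    rw [this]
    omega

lemma IsMatchingMap.exists_remove (hμ : G.IsMatchingMap μ) {a : V} (ha : μ a ≠ a) :
    ∃ μ', G.IsMatchingMap μ' ∧ (∀ x, μ x = x → μ' x = x) ∧ μ' a = a ∧ μ' (μ a) = μ a ∧
      (unmatched μ').card = (unmatched μ).card + 2 := by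
  have hinv := hμ.1
  let μ' : V → V := fun x => if x = a ∨ x = μ a then x else μ x
  have e3 : ∀ x, ¬ (x = a ∨ x = μ a) → μ' x = μ x := fun x h => by simp only [μ', h, if_false]
  have e4 : ∀ x, (x = a ∨ x = μ a) → μ' x = x := fun x h => by simp only [μ', h, if_true]
  have hmem : ∀ x, ¬ (x = a ∨ x = μ a) → ¬ (μ x = a ∨ μ x = μ a) := by
    rintro x hx (h | h)
    · exact hx (.inr (by rw [← hinv x, h]))
    · exact hx (.inl (hinv.injective h))
  refine ⟨μ', ⟨fun x => ?_, fun x hx => ?_⟩, fun x hx => ?_, e4 a (.inl rfl), e4 _ (.inr rfl), ?_⟩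
  · by_cases h : x = a ∨ x = μ a
    · rw [e4 x h, e4 x h]
    · rw [e3 x h, e3 _ (hmem x h), hinv]
  · by_cases h : x = a ∨ x = μ a
    · exact absurd (e4 x h) hx
    · rw [e3 x h] at hx ⊢
      exact hμ.2 x hx
  · by_cases h : x = a ∨ x = μ a
    · exact e4 x h
    · rw [e3 x h, hx]
  · have : unmatched μ' = insert a (insert (μ a) (unmatched μ)) := by
      ext x
      rw [Finset.mem_insert, Finset.mem_insert, mem_unmatched, mem_unmatched]
      by_cases h : x = a ∨ x = μ a
      · simp only [e4 x h, true_iff]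
        tauto
      · rw [e3 x h]
        tauto
    rw [this, Finset.card_insert_of_notMem, Finset.card_insert_of_notMem]
    · rw [mem_unmatched, hinv]
      exact ha.symm
    · rw [Finset.mem_insert, mem_unmatched, not_or]
      exact ⟨ha.symm, ha⟩

/-- There is a matching without augmenting paths of length one or three. -/
theorem exists_matchingMap_maximal (G : SimpleGraph V) : ∃ μ : V → V, G.IsMatchingMap μ ∧
    (∀ u v, μ u = u → μ v = v → ¬ G.Adj u v) ∧
    ∀ u v a, μ u = u → μ v = v → G.Adj u a → G.Adj v (μ a) → u = v := by
  obtain ⟨μ, hμ, hmin⟩ := (measure fun μ : V → V => (unmatched μ).card).wf.has_min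
    {μ | G.IsMatchingMap μ} ⟨id, fun _ => rfl, fun x hx => absurd rfl hx⟩
  have hmin' : ∀ μ', G.IsMatchingMap μ' → (unmatched μ).card ≤ (unmatched μ').card :=
    fun μ' h => not_lt.1 (hmin μ' h)
  have hindep : ∀ u v, μ u = u → μ v = v → ¬ G.Adj u v := by
    intro u v hu hv huv
    obtain ⟨μ', h', -, hc⟩ := IsMatchingMap.exists_add hμ huv hu hv
    have := hmin' μ' h'
    omega
  refine ⟨μ, hμ, hindep, fun u v a hu hv hua hva => ?_⟩
  by_contra huv
  have ha : μ a ≠ a := fun h => hindep u a hu h hua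
  have hua' : u ≠ μ a := fun h =>
    ha (h.symm.trans (hu.symm.trans (by rw [h, hμ.1 a])))
  have hva' : v ≠ a := fun h => ha (h ▸ hv)
  -- Augment along the path `u, a, μ a, v`: remove one edge, then add two.
  obtain ⟨μ₁, h₁, hfix, hfa, hfb, hc₁⟩ := IsMatchingMap.exists_remove hμ ha
  obtain ⟨μ₂, h₂, hsame, hc₂⟩ := h₁.exists_add hua (hfix u hu) hfa
  obtain ⟨μ₃, h₃, -, hc₃⟩ := h₂.exists_add hva
    (by rw [hsame v (Ne.symm huv) hva', hfix v hv])
    (by rw [hsame _ hua'.symm ha, hfb])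
  have := hmin' μ₃ h₃
  omega

/-- The number of vertices left unmatched has the parity of the order. -/
lemma IsMatchingMap.even_card_unmatched {μ : V → V} (hμ : G.IsMatchingMap μ)
    (heven : Even (Fintype.card V)) : Even (unmatched μ).card := by
  have h := Equiv.Perm.card_compl_support_modEq (p := 2) (n := 1) (σ := hμ.1.toPerm μ) (by
    ext x
    simp [pow_two, hμ.1 x])
  have hs : (hμ.1.toPerm μ).supportᶜ = unmatched μ := by
    ext x
    simp [mem_unmatched]
  rw [hs] at h
  rw [Nat.even_iff] at heven ⊢
  exact Eq.trans h heven

/-- In a regular graph, the vertices left unmatched by a suitable matching have neighbors in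
distinct pairs of the matching. -/
theorem IsRegularOfDegree.exists_matchingMap [DecidableRel G.Adj] {d : ℕ}
    (hreg : G.IsRegularOfDegree d) (hd : 2 ≤ d) :
    ∃ μ α : V → V, G.IsMatchingMap μ ∧
      (∀ u, μ u = u → G.Adj u (α u) ∧ μ (α u) ≠ α u) ∧
      ∀ u v, μ u = u → μ v = v → u ≠ v → α u ≠ α v ∧ α u ≠ μ (α v) := by
  obtain ⟨μ, hμ, hindep, haug⟩ := exists_matchingMap_maximal G
  let π : V → Sym2 V := fun a => s(a, μ a)
  have hπ : ∀ a b, π a = π b ↔ a = b ∨ a = μ b := by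
    intro a b
    simp only [π, Sym2.eq_iff]
    refine ⟨fun h => h.imp And.left And.left, ?_⟩
    rintro (rfl | rfl)
    · simp
    · simp [hμ.1 b]
  have hall : ∃ f : {u // μ u = u} → Sym2 V, Function.Injective f ∧
      ∀ u : {u // μ u = u}, f u ∈ (G.neighborFinset u).image π := by
    refine (Finset.all_card_le_biUnion_card_iff_exists_injective _).1 fun s => ?_
    let D : Finset (Σ _ : {u // μ u = u}, V) := s.sigma fun u => G.neighborFinset u
    have hmemD : ∀ u a, (⟨u, a⟩ : Σ _ : {u // μ u = u}, V) ∈ D ↔ u ∈ s ∧ G.Adj u a := by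
      simp [D]
    have hD : D.card = d * s.card := by
      rw [Finset.card_sigma, Finset.sum_congr rfl fun u _ => by
        rw [card_neighborFinset_eq_degree, hreg.degree_eq], Finset.sum_const, smul_eq_mul,
        mul_comm]
    have himage : (D.image fun p => π p.2) = s.biUnion fun u => (G.neighborFinset u).image π := by
      ext z
      simp only [Finset.mem_image, Finset.mem_biUnion, Sigma.exists, hmemD, mem_neighborFinset]
      exact ⟨fun ⟨u, a, ⟨hu, ha⟩, hz⟩ => ⟨u, hu, a, ha, hz⟩,
        fun ⟨u, hu, a, ha, hz⟩ => ⟨u, a, ⟨hu, ha⟩, hz⟩⟩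
    -- at most `d` edges lead from the unmatched vertices to a given pair
    have hfiber : ∀ z ∈ D.image fun p => π p.2, (D.filter fun p => π p.2 = z).card ≤ d := by
      intro z hz
      obtain ⟨⟨u₀, a⟩, h₀, rfl⟩ := Finset.mem_image.1 hz
      have hstar : ∀ b, (D.filter fun p => p.2 = b).card ≤ d := by
        intro b
        rw [← hreg.degree_eq b, ← card_neighborFinset_eq_degree]
        refine Finset.card_le_card_of_injOn (fun p => (p.1 : V)) ?_ ?_
        · rintro ⟨u, c⟩ hp
          rw [Finset.mem_coe, Finset.mem_filter, hmemD] at hp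
          obtain ⟨hp, rfl⟩ := hp
          simpa using hp.2.symm
        · rintro ⟨u, c⟩ hp ⟨v, c'⟩ hp' h
          rw [Finset.mem_coe, Finset.mem_filter] at hp hp'
          obtain ⟨-, rfl⟩ := hp
          obtain ⟨-, rfl⟩ := hp'
          obtain rfl : u = v := Subtype.ext h
          rfl
      -- If both ends of the pair have neighbors in the unmatched set, the lack of augmenting paths
      -- of length three makes all these neighbors one vertex, giving at most two edges. Otherwise
      -- all the edges end at one vertex, of degree `d`.
      by_cases hA : ∃ u, (⟨u, a⟩ : Σ _ : {u // μ u = u}, V) ∈ D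
      · by_cases hB : ∃ v, (⟨v, μ a⟩ : Σ _ : {u // μ u = u}, V) ∈ D
        · obtain ⟨u, hu⟩ := hA
          obtain ⟨v, hv⟩ := hB
          refine le_trans ?_ hd
          have huv : u = v := Subtype.ext (haug u v a u.2 v.2 ((hmemD _ _).1 hu).2
            ((hmemD _ _).1 hv).2)
          refine (Finset.card_le_card (t := {⟨u, a⟩, ⟨u, μ a⟩}) ?_).trans Finset.card_le_two
          rintro ⟨w, b⟩ hp
          rw [Finset.mem_filter, hmemD] at hp
          rcases (hπ b a).1 hp.2 with rfl | rfl
          · have : w = u := huv ▸ Subtype.ext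
              (haug w v b w.2 v.2 hp.1.2 ((hmemD _ _).1 hv).2)
            simp [this]
          · have : w = u := (Subtype.ext (haug u w a u.2 w.2 ((hmemD _ _).1 hu).2 hp.1.2)).symm
            simp [this]
        · refine (Finset.card_le_card ?_).trans (hstar a)
          rintro ⟨w, b⟩ hp
          rw [Finset.mem_filter] at hp ⊢
          refine ⟨hp.1, ((hπ b a).1 hp.2).resolve_right ?_⟩
          rintro rfl
          exact hB ⟨w, hp.1⟩
      · refine (Finset.card_le_card ?_).trans (hstar (μ a))
        rintro ⟨w, b⟩ hp
        rw [Finset.mem_filter] at hp ⊢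
        refine ⟨hp.1, ((hπ b a).1 hp.2).resolve_left ?_⟩
        rintro rfl
        exact hA ⟨w, hp.1⟩
    have := Finset.card_le_mul_card_image D d hfiber
    rw [hD, himage] at this
    exact Nat.le_of_mul_le_mul_left this (by omega)
  obtain ⟨f, hf, hft⟩ := hall
  have hα : ∀ u, ∃ a, (h : μ u = u) → G.Adj u a ∧ π a = f ⟨u, h⟩ := by
    intro u
    by_cases h : μ u = u
    · obtain ⟨a, ha, ha'⟩ := Finset.mem_image.1 (hft ⟨u, h⟩)
      exact ⟨a, fun _ => ⟨by simpa using ha, ha'⟩⟩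
    · exact ⟨u, fun h' => absurd h' h⟩
  choose α hα using hα
  refine ⟨μ, α, hμ, fun u hu => ⟨(hα u hu).1, fun h => hindep u _ hu h (hα u hu).1⟩, ?_⟩
  intro u v hu hv huv
  rw [← not_or, ← hπ, (hα u hu).2, (hα v hv).2]
  exact fun h => huv (Subtype.ext_iff.1 (hf h))

end SimpleGraph

/-! ### Labelings by cyclic groups: odd and even order -/

namespace SimpleGraph

/-- A connected regular graph with at least three vertices has degree at least two and at least as
many edges as vertices. -/
lemma Connected.two_le_degree_of_isRegular {V : Type*} [Fintype V] {G : SimpleGraph V}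
    [DecidableRel G.Adj] {d : ℕ} (hconn : G.Connected)
    (hreg : G.IsRegularOfDegree d) (hV : 3 ≤ Fintype.card V) :
    2 ≤ d ∧ Fintype.card V ≤ G.edgeFinset.card := by
  have h1 := hconn.card_vert_le_card_edgeSet_add_one
  rw [Nat.card_eq_fintype_card, Nat.card_eq_fintype_card, ← edgeFinset_card] at h1
  have h2 := G.sum_degrees_eq_twice_card_edges
  rw [Finset.sum_congr rfl fun v _ => hreg.degree_eq v, Finset.sum_const, smul_eq_mul,
    Finset.card_univ] at h2
  have hd : 2 ≤ d := by
    by_contra h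
    -- Degree at most one would give `2 * (n - 1) ≤ n`, impossible for `n ≥ 3`.
    have : d ≤ 1 := by omega
    nlinarith
  exact ⟨hd, by nlinarith⟩

variable {V : Type*} [Fintype V] [DecidableEq V] {G : SimpleGraph V} [DecidableRel G.Adj]

/-- A labeling of the vertices by the nonzero elements of a cyclic group of odd order yields the
chromatic numbers of the central graph, provided that each pair `u`, `v` of nonadjacent vertices
with opposite labels contains a vertex `u` that has a neighbor labeled `-2` times the label
of `u`. -/
theorem Connected.chromaticNumbers_of_nonzero_labeling {m : ℕ} (hconn : G.Connected)
    (hE : Fintype.card V ≤ G.edgeFinset.card) (hV : 5 ≤ Fintype.card V)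
    (hcard : Fintype.card V = 2 * m) {l : V → ZMod (2 * m + 1)} (hl : Function.Injective l)
    (hl0 : ∀ v, l v ≠ 0) {P : Set V} (hP : ∀ u ∈ P, ∀ v ∈ P, l u + l v ≠ 0)
    (hP' : ∀ u v, Gᶜ.Adj u v → l u + l v = 0 → u ∈ P ∨ v ∈ P)
    (hnbr : ∀ u ∈ P, ∃ a, G.Adj u a ∧ l a = -(2 * l u)) :
    G.centralGraph.totalDistinguishingChromaticNumber = G.centralGraph.maxDegree + 1 ∧
      G.centralGraph.IsOfType 1 := by
  classical
  have : Fact (1 < 2 * m + 1) := ⟨by omega⟩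
  have h2 : IsUnit (2 : ZMod (2 * m + 1)) := by
    have : IsUnit ((2 : ℕ) : ZMod (2 * m + 1)) := (ZMod.isUnit_iff_coprime _ _).2 (by simp)
    exact_mod_cast this
  -- The value `1` is a nonzero default: by `hP'`, opposite nonadjacent pairs meet `P`.
  let E : V → V → ZMod (2 * m + 1) := fun u v =>
    if l u + l v = 0 then (if u ∈ P then l v else if v ∈ P then l u else 1) else l u + l v
  have hE0 : ∀ u v, E u v ≠ 0 := by
    intro u v
    simp only [E]
    split_ifs
    exacts [hl0 v, hl0 u, one_ne_zero, ‹_›]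
  -- the color of a pair with opposite labels
  have hopp : ∀ u v, Gᶜ.Adj u v → l u + l v = 0 →
      (∃ a, G.Adj u a ∧ E u v = l u + l a) ∨ E u v = l u := by
    intro u v huv h
    by_cases hu : u ∈ P
    · obtain ⟨a, ha, hla⟩ := hnbr u hu
      refine .inl ⟨a, ha, ?_⟩
      simp only [E, h, hu, if_true]
      linear_combination h - hla
    · have hv := (hP' u v huv h).resolve_left hu
      refine .inr ?_
      simp [E, h, hu, hv]
  have hreg : ∀ u v, l u + l v ≠ 0 → E u v = l u + l v := fun u v h => by simp [E, h]
  -- The replacement color at `u` is `l u + l a` with `a` a neighbor of `u` in `G`, or `l u + 0`;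
  -- neither is a sum with `u` itself or with a vertex nonadjacent to `u`.
  have hopp_ne : ∀ u v w, Gᶜ.Adj u v → (w = u ∨ Gᶜ.Adj u w) → l u + l v = 0 →
      E u v ≠ l u + l w := by
    intro u v w huv hw h h'
    rcases hopp u v huv h with ⟨a, ha, hEa⟩ | hEu
    · obtain rfl : a = w := hl (by linear_combination h' - hEa)
      rcases hw with rfl | hw
      · exact ha.ne rfl
      · exact ((G.compl_adj u a).1 hw).2 ha
    · exact hl0 w (by linear_combination hEu - h')
  refine hconn.centralGraph_chromaticNumbers (C := {x : ZMod (2 * m + 1) // x ≠ 0}) hE hV ?_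
    (c := fun v => ⟨2 * l v, fun h => hl0 v (h2.mul_right_eq_zero.1 h)⟩) ?_
    (e := fun u v => ⟨E u v, hE0 u v⟩) ?_ ?_ ?_
  · rw [Fintype.card_subtype_compl, Fintype.card_subtype_eq, ZMod.card, hcard]
    rfl
  · intro u v h
    exact hl (h2.mul_left_cancel (Subtype.ext_iff.1 h))
  · intro u v
    refine Subtype.ext ?_
    simp only [E, add_comm (l v)]
    by_cases h : l u + l v = 0
    · by_cases hu : u ∈ P <;> by_cases hv : v ∈ P
      · exact absurd h (hP u hu v hv)
      all_goals simp [h, hu, hv]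
    · simp [h]
  · intro u v huv h
    have h' : E u v = l u + l u := (Subtype.ext_iff.1 h).trans (two_mul _)
    by_cases h0 : l u + l v = 0
    · exact hopp_ne u v u huv (.inl rfl) h0 h'
    · rw [hreg u v h0] at h'
      exact huv.ne (hl (add_left_cancel h')).symm
  · intro u v w huv huw hvw h
    have h' : E u v = E u w := Subtype.ext_iff.1 h
    by_cases h0 : l u + l v = 0 <;> by_cases h1 : l u + l w = 0
    · exact hvw (hl (add_left_cancel (h0.trans h1.symm)))
    · exact hopp_ne u v w huv (.inr huw) h0 (h'.trans (hreg u w h1))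
    · exact hopp_ne u w v huw (.inr huv) h1 (h'.symm.trans (hreg u v h0))
    · rw [hreg u v h0, hreg u w h1] at h'
      exact hvw (hl (add_left_cancel h'))

/-- The central graph of a connected graph of odd order which is not a tree. -/
theorem Connected.chromaticNumbers_of_odd (hconn : G.Connected)
    (hE : Fintype.card V ≤ G.edgeFinset.card) (hV : 5 ≤ Fintype.card V)
    (hodd : Odd (Fintype.card V)) :
    G.centralGraph.totalDistinguishingChromaticNumber = G.centralGraph.maxDegree + 1 ∧
      G.centralGraph.IsOfType 1 := by
  have : NeZero (Fintype.card V) := ⟨by omega⟩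
  have h2 : IsUnit (2 : ZMod (Fintype.card V)) := by
    have : IsUnit ((2 : ℕ) : ZMod (Fintype.card V)) :=
      (ZMod.isUnit_iff_coprime _ _).2 (Nat.coprime_two_left.2 hodd)
    exact_mod_cast this
  -- The vertex color `2 * l v` is the one value `l v + l w` not taken by any `w ≠ v`.
  let l : V ≃ ZMod (Fintype.card V) := Fintype.equivOfCardEq (ZMod.card _).symm
  refine hconn.centralGraph_chromaticNumbers hE hV (ZMod.card _) (c := fun v => 2 * l v)
    (fun u v h => l.injective (h2.mul_left_cancel h)) (e := fun u v => l u + l v)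
    (fun u v => add_comm _ _) (fun u v huv h => ?_)
    (fun u v w _ _ hvw h => hvw (l.injective (add_left_cancel h)))
  rw [two_mul] at h
  exact huv.ne (l.injective (add_left_cancel h)).symm

/-- The central graph of a connected regular graph of even order. -/
theorem Connected.chromaticNumbers_of_even (hconn : G.Connected) {d : ℕ}
    (hreg : G.IsRegularOfDegree d) (hd : 2 ≤ d)
    (hE : Fintype.card V ≤ G.edgeFinset.card) (hV : 5 ≤ Fintype.card V)
    (heven : Even (Fintype.card V)) :
    G.centralGraph.totalDistinguishingChromaticNumber = G.centralGraph.maxDegree + 1 ∧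
      G.centralGraph.IsOfType 1 := by
  classical
  obtain ⟨m, hm⟩ := heven.two_dvd
  obtain ⟨μ, α, hμ, hα, hαα⟩ := hreg.exists_matchingMap hd
  obtain ⟨t, ht⟩ := (hμ.even_card_unmatched heven).two_dvd
  -- the unmatched vertices, their chosen neighbors and the mates of these are distinct
  have h3t : 3 * t ≤ m := by
    have hinj : Set.InjOn α (unmatched μ : Set V) := by
      intro u hu v hv h
      by_contra huv
      exact (hαα u v (mem_unmatched.1 hu) (mem_unmatched.1 hv) huv).1 h
    have hd1 : Disjoint ((unmatched μ).image α) (((unmatched μ).image α).image μ) := by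
      rw [Finset.disjoint_left]
      intro x hx hx'
      obtain ⟨u, hu, rfl⟩ := Finset.mem_image.1 hx
      obtain ⟨y, hy, hyu⟩ := Finset.mem_image.1 hx'
      obtain ⟨v, hv, rfl⟩ := Finset.mem_image.1 hy
      rw [mem_unmatched] at hu hv
      by_cases huv : u = v
      · subst huv
        exact (hα u hu).2 hyu
      · exact (hαα u v hu hv huv).2 hyu.symm
    have hd2 : Disjoint (unmatched μ)
        ((unmatched μ).image α ∪ ((unmatched μ).image α).image μ) := by
      rw [Finset.disjoint_left]
      intro x hx hx'
      rw [mem_unmatched] at hx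
      rcases Finset.mem_union.1 hx' with hx' | hx'
      · obtain ⟨u, hu, rfl⟩ := Finset.mem_image.1 hx'
        exact (hα u (mem_unmatched.1 hu)).2 hx
      · obtain ⟨y, hy, rfl⟩ := Finset.mem_image.1 hx'
        obtain ⟨u, hu, rfl⟩ := Finset.mem_image.1 hy
        exact (hα u (mem_unmatched.1 hu)).2 (hμ.1.injective hx)
    have h := Finset.card_le_univ
      (unmatched μ ∪ ((unmatched μ).image α ∪ ((unmatched μ).image α).image μ))
    rw [Finset.card_union_of_disjoint hd2, Finset.card_union_of_disjoint hd1,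
      Finset.card_image_of_injective _ hμ.1.injective, Finset.card_image_of_injOn hinj] at h
    omega
  obtain ⟨I, hIcard, hI⟩ := ZMod.exists_finset_disjoint_doubles m t h3t
  obtain ⟨z⟩ : Nonempty (Fin t ↪ I) :=
    Function.Embedding.nonempty_of_card_le (by simpa using hIcard)
  -- The two vertices `θ (i, false)` and `θ (i, true)` form the `i`-th pair of unmatched vertices.
  let θ : Fin t × Bool ≃ unmatched μ := Fintype.equivOfCardEq (by
    rw [Fintype.card_coe, ht]
    simp [mul_comm])
  have hθ : ∀ p, μ (θ p) = θ p := fun p => mem_unmatched.1 (θ p).2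
  have hθinj : ∀ p q, (θ p : V) = θ q → p = q := fun p q h => θ.injective (Subtype.ext h)
  -- the matching, together with a pairing of the unmatched vertices
  let τ : V → V := fun x =>
    if h : x ∈ unmatched μ then θ ((θ.symm ⟨x, h⟩).1, !(θ.symm ⟨x, h⟩).2) else μ x
  have hτθ : ∀ i b, τ (θ (i, b)) = θ (i, !b) := by
    intro i b
    simp [τ]
  have hτμ : ∀ x, μ x ≠ x → τ x = μ x := fun x hx => by simp [τ, mem_unmatched, hx]
  have hcases : ∀ x, μ x ≠ x ∨ ∃ i b, x = θ (i, b) := by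
    intro x
    by_cases hx : μ x = x
    · exact .inr ⟨(θ.symm ⟨x, mem_unmatched.2 hx⟩).1, (θ.symm ⟨x, mem_unmatched.2 hx⟩).2,
        by simp⟩
    · exact .inl hx
  have hμμ : ∀ x, μ x ≠ x → μ (μ x) ≠ μ x := fun x hx h => hx (hμ.1.injective h)
  have hτ : τ.Involutive := by
    intro x
    rcases hcases x with hx | ⟨i, b, rfl⟩
    · rw [hτμ x hx, hτμ _ (hμμ x hx), hμ.1 x]
    · rw [hτθ, hτθ, Bool.not_not]
  have hτ' : ∀ x, τ x ≠ x := by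
    intro x
    rcases hcases x with hx | ⟨i, b, rfl⟩
    · rwa [hτμ x hx]
    · rw [hτθ]
      intro h
      simpa using hθinj _ _ h
  let S := {x : ZMod (2 * m + 1) // x ≠ 0}
  let ν : S → S := fun x => ⟨-x, neg_ne_zero.2 x.2⟩
  have h2 : IsUnit (2 : ZMod (2 * m + 1)) := by
    have : IsUnit ((2 : ℕ) : ZMod (2 * m + 1)) := (ZMod.isUnit_iff_coprime _ _).2 (by simp)
    exact_mod_cast this
  have hν : ν.Involutive := fun x => Subtype.ext (neg_neg _)
  have hν' : ∀ x, ν x ≠ x := by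
    intro x h
    have h' : -(x : ZMod (2 * m + 1)) = x := Subtype.ext_iff.1 h
    exact x.2 (h2.mul_right_eq_zero.1 (by linear_combination -h'))
  have hcardS : Fintype.card V = Fintype.card S := by
    rw [Fintype.card_subtype_compl, Fintype.card_subtype_eq, ZMod.card, hm]
    rfl
  have hz0 : ∀ i, ((z i : I) : ZMod (2 * m + 1)) ≠ 0 := by
    intro i h
    exact (hI _ (z i).2 _ (z i).2).1 (by rw [h, neg_zero])
  have hzinj : ∀ i j, ((z i : I) : ZMod (2 * m + 1)) = z j → i = j := fun i j h =>
    z.injective (Subtype.ext h)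
  have hz := fun i j => hI _ (z i).2 _ (z j).2
  -- Prescribed labels: `z i` for the first vertex of the `i`-th pair and `-2 * z i` for its chosen
  -- neighbor. Equivariance gives their partners the opposite labels, and the choice of `I` keeps
  -- all of these distinct.
  let Φ : Fin t × Bool → V := fun p => if p.2 then α (θ (p.1, false)) else θ (p.1, false)
  let Ψ : Fin t × Bool → S := fun p =>
    if p.2 then ⟨-(2 * (z p.1 : I)), neg_ne_zero.2 fun h => hz0 p.1 (h2.mul_right_eq_zero.1 h)⟩
    else ⟨(z p.1 : I), hz0 p.1⟩
  have hαθ : ∀ i, μ (α (θ (i, false))) ≠ α (θ (i, false)) := fun i => (hα _ (hθ _)).2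
  have hαθ' : ∀ i p, α (θ (i, false)) ≠ θ p := fun i p h => hαθ i (by rw [h, hθ])
  have hij : ∀ {i j}, i ≠ j → (θ (i, false) : V) ≠ θ (j, false) := fun h h' =>
    h (Prod.mk.inj (hθinj _ _ h')).1
  have hΦ : Function.Injective Φ := by
    rintro ⟨i, b⟩ ⟨j, b'⟩ h
    cases b <;> cases b' <;> simp [Φ] at h
    · exact hθinj _ _ (Subtype.ext_iff.1 (by simpa using h))
    · exact absurd h.symm (hαθ' _ _)
    · exact absurd h (hαθ' _ _)
    · by_cases hne : i = j
      · rw [hne]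
      · exact absurd h (hαα _ _ (hθ _) (hθ _) (hij hne)).1
  have hΦ' : ∀ p q, Φ p ≠ τ (Φ q) := by
    rintro ⟨i, b⟩ ⟨j, b'⟩ h
    cases b <;> cases b' <;> simp only [Φ, if_true, Bool.false_eq_true, if_false] at h
    · rw [hτθ] at h
      simpa using hθinj _ _ h
    · rw [hτμ _ (hαθ j)] at h
      exact hμμ _ (hαθ j) (by rw [← h, hθ])
    · rw [hτθ] at h
      exact hαθ' _ _ h
    · rw [hτμ _ (hαθ j)] at h
      by_cases hne : i = j
      · subst hne
        exact hαθ i h.symm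
      · exact (hαα _ _ (hθ _) (hθ _) (hij hne)).2 h
  have hΨ : Function.Injective Ψ := by
    rintro ⟨i, b⟩ ⟨j, b'⟩ h
    replace h := congrArg Subtype.val h
    cases b <;> cases b' <;>
      simp only [Ψ, if_true, Bool.false_eq_true, if_false] at h
    · rw [hzinj i j h]
    · exact absurd h (hz i j).2.2
    · exact absurd h.symm (hz j i).2.2
    · rw [hzinj i j (h2.mul_left_cancel (neg_injective h))]
  have hΨ' : ∀ p q, Ψ p ≠ ν (Ψ q) := by
    rintro ⟨i, b⟩ ⟨j, b'⟩ h
    replace h := congrArg Subtype.val h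
    cases b <;> cases b' <;>
      simp only [Ψ, ν, if_true, Bool.false_eq_true, if_false, neg_neg] at h
    · exact (hz i j).1 h
    · exact (hz i j).2.1 h
    · exact (hz j i).2.1 (neg_injective h).symm
    · exact (hz j i).1 (h2.mul_left_cancel (by linear_combination -h))
  obtain ⟨l, hl, hlτ, hlΦ⟩ :=
    hτ.exists_equivariant_injective hcardS hν hτ' hν' hΦ hΦ' hΨ hΨ'
  have hτl : ∀ u v, (l u : ZMod (2 * m + 1)) + l v = 0 → v = τ u := by
    intro u v h
    refine hl ?_
    rw [hlτ]
    refine Subtype.ext ?_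
    change (l v : ZMod (2 * m + 1)) = -l u
    linear_combination h
  refine hconn.chromaticNumbers_of_nonzero_labeling hE hV hm (l := fun v => (l v).1)
    (Subtype.val_injective.comp hl) (fun v => (l v).2)
    (P := Set.range fun i => (θ (i, false) : V)) ?_ ?_ ?_
  · rintro _ ⟨i, rfl⟩ _ ⟨j, rfl⟩ h
    have h' := hτl _ _ h
    simp only [hτθ] at h'
    simpa using hθinj _ _ h'
  · intro u v huv h
    obtain rfl := hτl _ _ h
    rcases hcases u with hu | ⟨i, b, rfl⟩
    · rw [hτμ u hu] at huv
      exact absurd (hμ.2 u hu) ((G.compl_adj _ _).1 huv).2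
    · cases b
      · exact .inl ⟨i, rfl⟩
      · exact .inr ⟨i, by rw [hτθ, Bool.not_true]⟩
  · rintro _ ⟨i, rfl⟩
    refine ⟨α (θ (i, false)), (hα _ (hθ _)).1, ?_⟩
    have e1 := hlΦ (i, false)
    have e2 := hlΦ (i, true)
    simp only [Φ, Ψ, if_true, Bool.false_eq_true, if_false] at e1 e2
    simp only [e1, e2]

end SimpleGraph

theorem theorem4p5 {V : Type*} [Fintype V] [DecidableEq V] (G : SimpleGraph V)
    [DecidableRel G.Adj] (n : ℕ) (hcard : Fintype.card V = n) (hn : 5 ≤ n)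
    (hconn : G.Connected) (hreg : ∃ d : ℕ, G.IsRegularOfDegree d) :
    (Odd n →
      G.centralGraph.totalDistinguishingChromaticNumber = G.centralGraph.maxDegree + 1) ∧
    (Even n → ¬ Nonempty (G ≃g (⊤ : SimpleGraph (Fin n))) →
      (G.maxDegree : ℝ) ≤ (2 * (n : ℝ) - 29) / 6 →
      G.centralGraph.totalDistinguishingChromaticNumber = G.centralGraph.maxDegree + 1) ∧
    ((Odd n ∨ (Even n ∧ ¬ Nonempty (G ≃g (⊤ : SimpleGraph (Fin n))) ∧
        (G.maxDegree : ℝ) ≤ (2 * (n : ℝ) - 29) / 6)) →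
      G.centralGraph.IsOfType 1) := by
  subst hcard
  obtain ⟨d, hreg⟩ := hreg
  obtain ⟨hd, hE⟩ := hconn.two_le_degree_of_isRegular hreg (by omega)
  refine ⟨fun h => (hconn.chromaticNumbers_of_odd hE hn h).1,
    fun h _ _ => (hconn.chromaticNumbers_of_even hreg hd hE hn h).1, ?_⟩
  rintro (h | ⟨h, -⟩)
  · exact (hconn.chromaticNumbers_of_odd hE hn h).2
  · exact (hconn.chromaticNumbers_of_even hreg hd hE hn h).2
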